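/- Let $E$ be a finite set, $I\subseteq E\times E$ an irreflexive symmetric relation, and $M(E,I)$ the free partially commutative monoid, i.e. the monoid with generators $E$ and relations $ab=ba$ for $(a,b)\in I$. Let $M(E,I)$ act from the right on the pointed set $X_0^{\bullet}=\{x_0,*\}$ by maps fixing the base point $*$. Let $\mathfrak{Cat}_*[X_0^{\bullet}]$ be the category whose objects are the elements of $X_0^{\bullet}$ and whose morphisms $x\to x'$ are the $\mu\in M(E,I)$ with $x\cdot\mu=x'$, the composition of $\mu\colon x\to x'$ and $\mu'\colon x'\to x''$ being $\mu\mu'$. Let $\mathbb{Z}[x_0]\colon\mathfrak{Cat}_*[X_0^{\bullet}]\to\mathrm{Ab}$ be the functor with $\mathbb{Z}[x_0](x_0)=\mathbb{Z}$ and $\mathbb{Z}[x_0](*)=0$, which is the identity of $\mathbb{Z}$ on all morphisms $x_0\to x_0$. For a functor $F\colon\mathscr{A}\to\mathrm{Ab}$ on a small category let $\varinjlim_n^{\mathscr{A}}F$ be the $n$-th homology group of the chain complex with $C_n(\mathscr{A},F)=\bigoplus_{a_0\to\cdots\to a_n}F(a_0)$ and differential $\sum_{i}(-1)^i d_i$ (the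 usual complex computing the left derived functors of the colimit). Then the following hold. 1. The group $\varinjlim_1^{\mathfrak{Cat}_*[X_0^{\bullet}]}\mathbb{Z}[x_0]$ has no torsion, i.e. its torsion subgroup is zero. 2. If $x_0\cdot e=*$ for all $e\in E$, then $\varinjlim_1^{\mathfrak{Cat}_*[X_0^{\bullet}]}\mathbb{Z}[x_0]\cong\widetilde H_0(E,\mathfrak{M})$, where $(E,\mathfrak{M})$ is the simplicial scheme with vertex set $E$ whose simplices are the non-empty finite sets of pairwise commuting generators (that is, $(a,b)\in I$ for distinct $a,b$), and $\widetilde H_*$ is the reduced homology, computed by the augmented complex of simplices $e_0<\cdots<e_n$ for any total order on $E$. 3. The group $\widetilde H_0(E,\mathfrak{M})$ is free abelian. -/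

import Mathlib

open CategoryTheory Opposite
open scoped DirectSum RightActions

universe u v w

/-! ### Free partially commutative monoids and their pointed right sets -/

/-- The defining relations `ab = ba`, for `I a b`, of the free partially commutative monoid. -/
inductive CommRelation {E : Type u} (I : E → E → Prop) : FreeMonoid E → FreeMonoid E → Prop
  | comm (a b : E) (h : I a b) :
      CommRelation I (FreeMonoid.of a * FreeMonoid.of b) (FreeMonoid.of b * FreeMonoid.of a)

/-- The monoid `M(E, I)` with set of generators `E` and relations `ab = ba` for `I a b`. -/
abbrev PartiallyCommMonoid {E : Type u} (I : E → E → Prop) : Type u :=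
  PresentedMonoid (CommRelation I)

/-- The generator of `M(E, I)` given by an element of `E`. -/
abbrev PartiallyCommMonoid.gen {E : Type u} (I : E → E → Prop) (e : E) : PartiallyCommMonoid I :=
  PresentedMonoid.of (CommRelation I) e

/-- The pointed set `X ∪ {*}`. -/
inductive PointedSet (X : Type v) : Type v
  | base : PointedSet X
  | pt (x : X) : PointedSet X

/-- A right action `x <• m` of the monoid `M` on the pointed set `X ∪ {*}` by based maps. -/
class PointedRightAction (M : Type u) [Monoid M] (X : Type v) extends
    MulAction Mᵐᵒᵖ (PointedSet X) where
  base_act (m : M) : (PointedSet.base : PointedSet X) <• m = PointedSet.base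

/-- The category of a pointed right `M`-set: its objects are the elements of `X ∪ {*}`, a morphism
`x ⟶ x'` is an element `m` of `M` with `x <• m = x'`, and the composition of `m : x ⟶ x'` and
`m' : x' ⟶ x''` is `m * m'` (which is `op m' * op m` in `Mᵐᵒᵖ`). -/
abbrev PointedSetCat (M : Type u) [Monoid M] (X : Type v) [PointedRightAction M X] :=
  ActionCategory Mᵐᵒᵖ (PointedSet X)

section Coefficients

variable {M : Type u} [Monoid M] {X : Type v} [PointedRightAction M X]

/-- There is no morphism from the base point to another point. -/
theorem PointedSetCat.eq_base_of_hom {p q : PointedSetCat M X} (f : p ⟶ q)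
    (hp : p.back = PointedSet.base) : q.back = PointedSet.base := by
  have h : (show Mᵐᵒᵖ from f.val) • p.back = q.back := f.property
  rw [hp] at h
  rw [← h]
  exact PointedRightAction.base_act (M := M) (X := X) (MulOpposite.unop (show Mᵐᵒᵖ from f.val))

/-- The values on objects of the functor `ℤ[X]`: the group `ℤ` at every point of `X`, and `0` at the
base point. -/
def intCoeffObj : PointedSet X → AddCommGrpCat.{0}
  | .pt _ => AddCommGrpCat.of ℤ
  | .base => AddCommGrpCat.of PUnit

/-- The values on morphisms of the functor `ℤ[X]`: the identity of `ℤ` between points of `X`, and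
zero if the source or the target is the base point. -/
def intCoeffMap : (x y : PointedSet X) → (intCoeffObj x ⟶ intCoeffObj y)
  | .pt _, .pt _ => 𝟙 (AddCommGrpCat.of ℤ)
  | .pt _, .base => 0
  | .base, _ => 0

variable (M X) in
/-- The functor `ℤ[X]` (that is `ℤ[x₀, …, xₙ]` for `X = {x₀, …, xₙ}`) on the category of the
pointed right `M`-set `X ∪ {*}`. -/
def intCoeff : PointedSetCat M X ⥤ AddCommGrpCat.{0} where
  obj p := intCoeffObj p.back
  map {p q} _ := intCoeffMap p.back q.back
  map_id p := by
    rcases h : p.back with _ | x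
    · ext x; exact Subsingleton.elim (α := PUnit) _ _
    · rfl
  map_comp {p q r} f g := by
    have hg := PointedSetCat.eq_base_of_hom g
    revert hg
    generalize p.back = x, q.back = y, r.back = z
    intro hg
    rcases x with _ | x
    · simp [intCoeffMap]
    · rcases y with _ | y
      · rw [hg rfl]
        simp [intCoeffMap]
      · rcases z with _ | z
        · exact (Limits.comp_zero (f := 𝟙 (AddCommGrpCat.of ℤ))).symm
        · exact (Category.id_comp (𝟙 (AddCommGrpCat.of ℤ))).symm

end Coefficients

/-! ### Derived functors of the colimit -/

section DerivedColimit

variable {A : Type u} [Category.{v} A] (F : A ⥤ AddCommGrpCat.{w})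

open scoped Classical in
/-- The map `⨁_{a₀ → ⋯ → aₙ} F(a₀) ⟶ ⨁_{b₀ → ⋯ → bₘ} F(b₀)` induced by a monotone map `θ` from
`{0, …, m}` to `{0, …, n}`: it sends the summand of `a₀ → ⋯ → aₙ` to the summand of
`a_{θ 0} → ⋯ → a_{θ m}` by `F(a₀ → a_{θ 0})`. -/
noncomputable def simplicialReplacementMap {Δ Δ' : SimplexCategory} (θ : Δ' ⟶ Δ) :
    (⨁ σ : ComposableArrows A Δ.len, F.obj (σ.obj 0)) →+
      ⨁ τ : ComposableArrows A Δ'.len, F.obj (τ.obj 0) :=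
  DirectSum.toAddMonoid fun σ =>
    (DirectSum.of (fun τ : ComposableArrows A Δ'.len => F.obj (τ.obj 0))
      (σ.whiskerLeft θ.toOrderHom.monotone.functor)).comp
      (F.map (σ.map (homOfLE (Fin.zero_le (θ.toOrderHom 0))))).hom

open scoped Classical in
theorem simplicialReplacementMap_of {Δ Δ' : SimplexCategory} (θ : Δ' ⟶ Δ)
    (σ : ComposableArrows A Δ.len) (x : F.obj (σ.obj 0)) :
    simplicialReplacementMap F θ (DirectSum.of (fun σ : ComposableArrows A Δ.len =>
      F.obj (σ.obj 0)) σ x) =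
    DirectSum.of (fun τ : ComposableArrows A Δ'.len => F.obj (τ.obj 0))
      (σ.whiskerLeft θ.toOrderHom.monotone.functor)
      (F.map (σ.map (homOfLE (Fin.zero_le (θ.toOrderHom 0)))) x) := by
  simp only [simplicialReplacementMap, DirectSum.toAddMonoid_of]
  rfl

theorem simplicialReplacementMap_id (Δ : SimplexCategory) :
    simplicialReplacementMap F (𝟙 Δ) = AddMonoidHom.id _ := by
  classical
  refine DirectSum.addHom_ext fun σ x => (simplicialReplacementMap_of F (𝟙 Δ) σ x).trans ?_
  exact congrArg (DirectSum.of (fun τ : ComposableArrows A Δ.len => F.obj (τ.obj 0)) σ)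
    (ConcreteCategory.congr_hom
      ((congrArg F.map (σ.map_id 0)).trans (F.map_id _)) x)

theorem simplicialReplacementMap_comp {Δ Δ' Δ'' : SimplexCategory} (θ' : Δ'' ⟶ Δ') (θ : Δ' ⟶ Δ) :
    simplicialReplacementMap F (θ' ≫ θ) =
      (simplicialReplacementMap F θ').comp (simplicialReplacementMap F θ) := by
  classical
  refine DirectSum.addHom_ext fun σ x => (simplicialReplacementMap_of F (θ' ≫ θ) σ x).trans ?_
  refine Eq.trans ?_ ((congrArg (simplicialReplacementMap F θ')
    (simplicialReplacementMap_of F θ σ x)).trans (simplicialReplacementMap_of F θ' _ _)).symm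
  refine congrArg (DirectSum.of (fun τ : ComposableArrows A Δ''.len => F.obj (τ.obj 0)) _) ?_
  refine ConcreteCategory.congr_hom (?_ : F.map _ = F.map _ ≫ F.map _) x
  refine Eq.trans (congrArg F.map ?_) (F.map_comp _ _)
  exact (congrArg σ.map (Subsingleton.elim _ _)).trans (σ.map_comp _ _)

/-- The simplicial abelian group with `n`-simplices `⨁_{a₀ → ⋯ → aₙ} F(a₀)`. -/
noncomputable def simplicialReplacement : SimplicialObject AddCommGrpCat.{max u v w} where
  obj Δ := AddCommGrpCat.of (⨁ σ : ComposableArrows A Δ.unop.len, F.obj (σ.obj 0))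
  map θ := AddCommGrpCat.ofHom (simplicialReplacementMap F θ.unop)
  map_id Δ := by
    rw [unop_id, simplicialReplacementMap_id]
    rfl
  map_comp θ θ' := by
    rw [unop_comp, simplicialReplacementMap_comp]
    rfl

/-- The chain complex `C_*(A, F)` with `Cₙ(A, F) = ⨁_{a₀ → ⋯ → aₙ} F(a₀)` and differential
`∑ i, (-1)^i dᵢ`. -/
noncomputable def colimChainComplex : ChainComplex AddCommGrpCat.{max u v w} ℕ :=
  (AlgebraicTopology.alternatingFaceMapComplex AddCommGrpCat).obj (simplicialReplacement F)

/-- The `n`-th derived colimit of `F` over `A`: the homology group `Hₙ(C_*(A, F))`. -/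
noncomputable def derivedColim (n : ℕ) : AddCommGrpCat.{max u v w} :=
  (colimChainComplex F).homology n

end DerivedColimit

/-! ### Reduced homology of simplicial schemes -/

section ReducedHomology

variable {V : Type u} [LinearOrder V] (K : AbstractSimplicialComplex V)

/-- The simplices with `n` vertices `v₀ < ⋯ < vₙ₋₁` of `K`, and the empty simplex for `n = 0`. -/
def AugSimplex (n : ℕ) : Type u :=
  {v : Fin n ↪o V // n = 0 ∨ Finset.univ.map v.toEmbedding ∈ K.faces}

variable {K} in
/-- The face of a simplex opposite to its `i`-th vertex. -/
def AugSimplex.face {n : ℕ} (s : AugSimplex K (n + 1)) (i : Fin (n + 1)) : AugSimplex K n :=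
  ⟨(Fin.succAboveOrderEmb i).trans s.1, by
    rcases Nat.eq_zero_or_pos n with h | h
    · exact Or.inl h
    · refine Or.inr ((K.isRelLowerSet_faces (s.2.resolve_left n.succ_ne_zero)).2 ?_ ?_)
      · intro x hx
        simp only [Finset.mem_map, Finset.mem_univ, true_and] at hx ⊢
        obtain ⟨j, rfl⟩ := hx
        exact ⟨i.succAbove j, rfl⟩
      · exact ⟨_, Finset.mem_map_of_mem _ (Finset.mem_univ ⟨0, h⟩)⟩⟩

/-- The boundary map `(v₀, …, vₙ) ↦ ∑ i, (-1)^i (v₀, …, v̂ᵢ, …, vₙ)`; for `n = 0` it is the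
augmentation. -/
noncomputable def augBoundary (n : ℕ) : (AugSimplex K (n + 1) →₀ ℤ) →+ (AugSimplex K n →₀ ℤ) :=
  (Finsupp.linearCombination ℤ fun s : AugSimplex K (n + 1) =>
    ∑ i : Fin (n + 1), (-1 : ℤ) ^ (i : ℕ) • Finsupp.single (s.face i) (1 : ℤ)).toAddMonoidHom

theorem augBoundary_single (n : ℕ) (s : AugSimplex K (n + 1)) :
    augBoundary K n (Finsupp.single s 1) =
      ∑ i : Fin (n + 1), (-1 : ℤ) ^ (i : ℕ) • Finsupp.single (s.face i) (1 : ℤ) := by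
  simp [augBoundary]

theorem augBoundary_comp (n : ℕ) : (augBoundary K n).comp (augBoundary K (n + 1)) = 0 := by
  refine Finsupp.addHom_ext' fun s => AddMonoidHom.ext_int ?_
  simp only [AddMonoidHom.comp_apply, Finsupp.singleAddHom_apply, augBoundary_single, map_sum,
    map_zsmul, Finset.smul_sum, smul_smul, AddMonoidHom.zero_apply]
  rw [← Finset.sum_product']
  refine Finset.sum_involution (fun ij _ => (ij.1.succAbove ij.2, ij.2.predAbove ij.1))
    ?_ ?_ ?_ ?_
  · rintro ⟨i, j⟩ -
    have h : ((s.face (i.succAbove j)).face (j.predAbove i)) = (s.face i).face j :=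
      Subtype.ext (RelEmbedding.ext fun k =>
        congrArg s.1 (Fin.succAbove_succAbove_succAbove_predAbove i j k))
    simp only [h, ← pow_add, Fin.neg_one_pow_succAbove_add_predAbove, ← add_smul]
    simp
  · rintro ⟨i, j⟩ - - h
    exact Fin.succAbove_ne i j (congrArg Prod.fst h)
  · simp
  · rintro ⟨i, j⟩ -
    exact Prod.ext (Fin.succAbove_succAbove_predAbove i j) (Fin.predAbove_predAbove_succAbove i j)

/-- The augmented ordered chain complex of `K`, shifted so that the simplices with `n` vertices are
in degree `n`. -/
noncomputable def augChainComplex : ChainComplex AddCommGrpCat.{u} ℕ :=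
  ChainComplex.of (fun n => AddCommGrpCat.of (AugSimplex K n →₀ ℤ))
    (fun n => AddCommGrpCat.ofHom (augBoundary K n))
    fun n => by rw [← AddCommGrpCat.ofHom_comp, augBoundary_comp]; rfl

/-- The `n`-th reduced homology group of `K`. -/
noncomputable def reducedHomology (n : ℕ) : AddCommGrpCat.{u} :=
  (augChainComplex K).homology (n + 1)

end ReducedHomology

/-- The simplicial scheme `(E, 𝔐)` of `M(E, I)`: its vertices are the generators, and its simplices
are the nonempty finite sets of pairwise commuting generators. -/
def commutingScheme {E : Type u} (I : E → E → Prop) : AbstractSimplicialComplex E where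
  faces := {s | s.Nonempty ∧ (s : Set E).Pairwise I}
  isRelLowerSet_faces := fun _ hs =>
    ⟨hs.1, fun _ hts ht => ⟨ht, hs.2.mono (Finset.coe_subset.mpr hts)⟩⟩
  singleton_mem v := ⟨Finset.singleton_nonempty v, by simp⟩

/-! ### First homology groups as subgroups -/

/-! Since `ℤ[x₀]` vanishes at `*`, the 1-chains are spanned by the arrows `[m]` out of `x₀`. Modulo
boundaries, `[mm'] = [m] + [m']` if `m` fixes `x₀`, and `[mm'] = [m]` if `m` sends it to `*`. So `m
↦ [m]` is the universal crossed homomorphism, determined by the generators. Let `T` be the set of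
generators sending `x₀` to `*`. The relation `ab = ba` gives `[a] = [b]` if both lie in `T`, `[a] =
0` if only `b` does, and nothing new if neither does. Hence chains modulo boundaries form a free
abelian group, realized as `genClassSpan` (`crossedChain_ker`, `crossedChain_range`).

The boundary to 0-chains becomes minus `genWeight`, so the first derived colimit is the kernel of
the weight on that span (`derivedColim_one_equiv`). As a subgroup of a free abelian group, it has no
torsion.

For the simplicial scheme, vertices modulo edges give the same construction with `T = Set.univ`, and
the augmentation is the weight (`reducedHomology_zero_equiv`). If every generator kills `x₀`, both
groups are therefore the same subgroup. -/

/-- If the kernel of `φ : K₁ → Q` is the group of boundaries, then `H₁(K)` is the image under `φ` of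
the group of cycles. -/
theorem homologyOne_equiv_map_ker (K : ChainComplex AddCommGrpCat.{u} ℕ) {Q : Type v}
    [AddCommGroup Q] (φ : K.X 1 →+ Q) (hφ : φ.ker = (K.d 2 1).hom.range) :
    Nonempty (K.homology 1 ≃+ (K.d 1 0).hom.ker.map φ) := by
  let S := K.sc' 2 1 0
  let e : K.homology 1 ≃+ (S.g.hom.ker ⧸ S.abToCycles.range) :=
    (K.homologyIsoSc' 2 1 0 (by simp) (by simp) ≪≫ S.abHomologyIso).addCommGroupIsoToAddEquiv
  let ψ : S.g.hom.ker →+ (K.d 1 0).hom.ker.map φ :=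
    (φ.comp (K.d 1 0).hom.ker.subtype).codRestrict _ fun x => ⟨x.1, x.2, rfl⟩
  have hψ : Function.Surjective ψ := by
    rintro ⟨_, x, hx, rfl⟩
    exact ⟨⟨x, hx⟩, rfl⟩
  have hker : ψ.ker = S.abToCycles.range := by
    ext ⟨x, hx⟩
    have h : φ x = 0 ↔ ∃ y, K.d 2 1 y = x := SetLike.ext_iff.mp hφ x
    change ψ ⟨x, hx⟩ = 0 ↔ ∃ y, S.abToCycles y = ⟨x, hx⟩
    refine (Subtype.ext_iff.trans (by exact h)).trans (exists_congr fun y => ?_)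
    exact (Subtype.ext_iff (a1 := S.abToCycles y) (a2 := ⟨x, hx⟩)).symm
  exact ⟨e.trans ((QuotientAddGroup.quotientAddEquivOfEq hker.symm).trans
    (QuotientAddGroup.quotientKerEquivOfSurjective ψ hψ))⟩

/-- A homomorphism that kills the boundaries and through which the quotient by the boundaries
factors has the boundaries as its kernel. -/
theorem AddMonoidHom.ker_eq_range_of_factor {A B Q : Type*} [AddCommGroup A] [AddCommGroup B]
    [AddCommGroup Q] (d : A →+ B) (φ : B →+ Q) (γ : Q →+ B ⧸ d.range) (h : φ.comp d = 0)
    (hγ : γ.comp φ = QuotientAddGroup.mk' d.range) : φ.ker = d.range := by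
  refine le_antisymm (fun x hx => ?_) ?_
  · rw [← QuotientAddGroup.eq_zero_iff]
    refine (DFunLike.congr_fun hγ x).symm.trans ?_
    rw [AddMonoidHom.comp_apply, AddMonoidHom.mem_ker.mp hx, map_zero]
  · rintro _ ⟨y, rfl⟩
    exact DFunLike.congr_fun h y

/-! ### The group of classes of generators -/

section GenClass

variable {E : Type u} {I : E → E → Prop} {T : Set E}

/-- For a set `T` of generators (those that send the point to the base point), commuting generators
of `T` are identified, and a generator outside `T` that commutes with one of `T` is identified with
the additional element `none`. -/
inductive GenRel (I : E → E → Prop) (T : Set E) : Option E → Option E → Prop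
  | glue (a b : E) (h : I a b) (ha : a ∈ T) (hb : b ∈ T) : GenRel I T (some a) (some b)
  | collapse (a b : E) (h : I a b) (ha : a ∉ T) (hb : b ∈ T) : GenRel I T (some a) none

/-- The free abelian group on the classes of `GenRel`. -/
abbrev GenClassGroup (I : E → E → Prop) (T : Set E) : Type u := Quot (GenRel I T) →₀ ℤ

variable (I T) in
/-- The class of a generator, normalized by the class of `none`. -/
noncomputable def genClass (e : E) : GenClassGroup I T :=
  Finsupp.single (Quot.mk _ (some e)) 1 - Finsupp.single (Quot.mk _ none) 1

theorem genClass_eq {a b : E} (h : I a b) (ha : a ∈ T) (hb : b ∈ T) :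
    genClass I T a = genClass I T b := by
  rw [genClass, genClass, Quot.sound (GenRel.glue a b h ha hb)]

theorem genClass_eq_zero {a b : E} (h : I a b) (ha : a ∉ T) (hb : b ∈ T) :
    genClass I T a = 0 := by
  rw [genClass, Quot.sound (GenRel.collapse a b h ha hb), sub_self]

/-- The homomorphism from `GenClassGroup I T` with prescribed values on classes of generators. -/
noncomputable def GenClassGroup.desc {G : Type*} [AddCommGroup G] (g : E → G)
    (hglue : ∀ a b, I a b → a ∈ T → b ∈ T → g a = g b)
    (hcollapse : ∀ a b, I a b → a ∉ T → b ∈ T → g a = 0) : GenClassGroup I T →+ G :=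
  -- The value 0 at `none` makes subtracting its class in `genClass` harmless and encodes the
  -- vanishing of collapsed generators.
  (Finsupp.linearCombination ℤ (Quot.lift (fun o : Option E => o.elim 0 g) (by
    rintro _ _ (⟨a, b, h, ha, hb⟩ | ⟨a, b, h, ha, hb⟩)
    · exact hglue a b h ha hb
    · exact hcollapse a b h ha hb))).toAddMonoidHom

@[simp]
theorem GenClassGroup.desc_genClass {G : Type*} [AddCommGroup G] (g : E → G)
    (hglue : ∀ a b, I a b → a ∈ T → b ∈ T → g a = g b)
    (hcollapse : ∀ a b, I a b → a ∉ T → b ∈ T → g a = 0) (e : E) :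
    GenClassGroup.desc g hglue hcollapse (genClass I T e) = g e := by
  simp [GenClassGroup.desc, genClass]

open scoped Classical in
variable (I T) in
/-- The homomorphism that takes the value `1` on the classes of the elements of `T`, and `0` on the
classes of the other generators. -/
noncomputable def genWeight : GenClassGroup I T →+ ℤ :=
  GenClassGroup.desc (fun e => if e ∈ T then 1 else 0)
    (fun a b _ ha hb => by rw [if_pos ha, if_pos hb]) (fun a b _ ha _ => if_neg ha)

theorem genWeight_genClass_of_mem {e : E} (he : e ∈ T) : genWeight I T (genClass I T e) = 1 := by
  simp [genWeight, he]

theorem genWeight_genClass_of_notMem {e : E} (he : e ∉ T) :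
    genWeight I T (genClass I T e) = 0 := by
  simp [genWeight, he]

variable (I T) in
/-- The subgroup of `GenClassGroup I T` generated by the classes of generators. -/
noncomputable def genClassSpan : AddSubgroup (GenClassGroup I T) :=
  AddSubgroup.closure (Set.range (genClass I T))

end GenClass

/-! ### Reduced homology of the simplicial scheme -/

section Reduced

variable {E : Type u} [LinearOrder E] {I : E → E → Prop}

/-- The vertex of a simplex with one vertex. -/
noncomputable def augVertexClass (I : E → E → Prop) :
    (AugSimplex (commutingScheme I) 1 →₀ ℤ) →+ GenClassGroup I Set.univ :=
  (Finsupp.linearCombination ℤ fun s : AugSimplex (commutingScheme I) 1 =>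
    genClass I Set.univ (s.1 0)).toAddMonoidHom

theorem augVertexClass_single (s : AugSimplex (commutingScheme I) 1) :
    augVertexClass I (Finsupp.single s 1) = genClass I Set.univ (s.1 0) := by
  simp [augVertexClass]

/-- The simplex with the only vertex `e`. -/
def augVertex (I : E → E → Prop) (e : E) : AugSimplex (commutingScheme I) 1 :=
  ⟨⟨⟨fun _ => e, fun _ _ _ => Subsingleton.elim _ _⟩, by
    intro a b
    simp [Subsingleton.elim a b]⟩, Or.inr (by
      refine ⟨by simp, ?_⟩
      intro x hx y hy hxy
      simp only [Finset.coe_map, Set.mem_image] at hx hy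
      obtain ⟨i, -, rfl⟩ := hx
      obtain ⟨j, -, rfl⟩ := hy
      exact absurd rfl hxy)⟩

theorem augVertex_eq (s : AugSimplex (commutingScheme I) 1) : augVertex I (s.1 0) = s := by
  refine Subtype.ext (RelEmbedding.ext fun i => ?_)
  rw [Subsingleton.elim i 0]
  rfl

/-- The simplex with the vertices `a < b`. -/
def augEdge (hsymm : ∀ a b, I a b → I b a) {a b : E} (hab : a < b) (h : I a b) :
    AugSimplex (commutingScheme I) 2 :=
  ⟨OrderEmbedding.ofStrictMono ![a, b] (by
    intro i j hij
    fin_cases i <;> fin_cases j <;> simp_all), Or.inr (by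
      refine ⟨by simp, ?_⟩
      intro x hx y hy hxy
      simp only [Finset.coe_map, Set.mem_image] at hx hy
      obtain ⟨i, -, rfl⟩ := hx
      obtain ⟨j, -, rfl⟩ := hy
      fin_cases i <;> fin_cases j
      · exact absurd rfl hxy
      · exact h
      · exact hsymm _ _ h
      · exact absurd rfl hxy)⟩

theorem augEdge_rel (s : AugSimplex (commutingScheme I) 2) : I (s.1 0) (s.1 1) := by
  have h := s.2.resolve_left two_ne_zero
  refine h.2 ?_ ?_ ?_
  · simp only [Finset.coe_map]
    exact ⟨0, by simp, rfl⟩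
  · simp only [Finset.coe_map]
    exact ⟨1, by simp, rfl⟩
  · exact fun h => zero_ne_one (s.1.injective h)

theorem augBoundary_edge (s : AugSimplex (commutingScheme I) 2) :
    augBoundary (commutingScheme I) 1 (Finsupp.single s 1) =
      Finsupp.single (augVertex I (s.1 1)) 1 - Finsupp.single (augVertex I (s.1 0)) 1 := by
  -- The face opposite a vertex of an edge is the other vertex.
  have h0 : s.face 0 = augVertex I (s.1 1) := (augVertex_eq _).symm
  have h1 : s.face 1 = augVertex I (s.1 0) := (augVertex_eq _).symm
  rw [augBoundary_single, Fin.sum_univ_two, h0, h1]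
  simp [sub_eq_add_neg]

/-- Edges identify exactly the commuting vertices, which is `GenRel` for `T = Set.univ`; the
collapsing relation is then vacuous. -/
theorem augVertexClass_ker (hsymm : ∀ a b, I a b → I b a) :
    (augVertexClass I).ker = (augBoundary (commutingScheme I) 1).range := by
  have key : ∀ a b : E, a < b → I a b →
      (QuotientAddGroup.mk' (augBoundary (commutingScheme I) 1).range)
        (Finsupp.single (augVertex I a) 1) =
      (QuotientAddGroup.mk' (augBoundary (commutingScheme I) 1).range)
        (Finsupp.single (augVertex I b) 1) := by
    intro a b hab h
    refine QuotientAddGroup.eq.mpr ⟨Finsupp.single (augEdge hsymm hab h) 1, ?_⟩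
    rw [augBoundary_edge, neg_add_eq_sub]
    rfl
  refine AddMonoidHom.ker_eq_range_of_factor _ _
    (GenClassGroup.desc (fun e => QuotientAddGroup.mk' (augBoundary (commutingScheme I) 1).range
      (Finsupp.single (augVertex I e) 1)) ?_ ?_) ?_ ?_
  · intro a b h _ _
    -- Edges are stored in increasing order, so a commuting pair may have to be swapped.
    rcases lt_trichotomy a b with hab | rfl | hab
    · exact key a b hab h
    · rfl
    · exact (key b a hab (hsymm _ _ h)).symm
  · exact fun a _ _ ha _ => absurd (Set.mem_univ a) ha
  · refine Finsupp.addHom_ext' fun s => AddMonoidHom.ext_int ?_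
    simp only [AddMonoidHom.comp_apply, Finsupp.singleAddHom_apply, augBoundary_edge, map_sub,
      augVertexClass_single, AddMonoidHom.zero_apply]
    exact sub_eq_zero.mpr (genClass_eq (augEdge_rel s) (Set.mem_univ _) (Set.mem_univ _)).symm
  · refine Finsupp.addHom_ext' fun _ => AddMonoidHom.ext_int ?_
    simp only [AddMonoidHom.comp_apply, Finsupp.singleAddHom_apply, augVertexClass_single,
      GenClassGroup.desc_genClass, augVertex_eq]

/-- The empty simplex spans degree 0 of the augmented complex, so the augmentation is integer
valued. -/
instance : Unique (AugSimplex (commutingScheme I) 0) where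
  default := ⟨⟨⟨Fin.elim0, fun i => i.elim0⟩, fun {i} => i.elim0⟩, Or.inl rfl⟩
  uniq _ := Subtype.ext (RelEmbedding.ext fun i => i.elim0)

/-- The augmentation and the weight both count each vertex once. -/
theorem augBoundary_zero_eq_zero_iff (x : AugSimplex (commutingScheme I) 1 →₀ ℤ) :
    augBoundary (commutingScheme I) 0 x = 0 ↔
      genWeight I Set.univ (augVertexClass I x) = 0 := by
  have h : augBoundary (commutingScheme I) 0 = (Finsupp.singleAddHom default).comp
      ((genWeight I Set.univ).comp (augVertexClass I)) := by
    refine Finsupp.addHom_ext' fun s => AddMonoidHom.ext_int ?_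
    simp only [AddMonoidHom.comp_apply, Finsupp.singleAddHom_apply, augBoundary_single]
    rw [augVertexClass_single, genWeight_genClass_of_mem (Set.mem_univ _)]
    simp [Subsingleton.elim (s.face 0) default]
  rw [h]
  simp

theorem augVertexClass_range : (augVertexClass I).range = genClassSpan I Set.univ := by
  refine le_antisymm ?_ ?_
  · rintro _ ⟨x, rfl⟩
    induction x using Finsupp.induction_linear with
    | zero => simp
    | add x y hx hy => rw [map_add]; exact add_mem hx hy
    | single s n =>
      rw [show Finsupp.single s n = n • Finsupp.single s (1 : ℤ) by simp, map_zsmul,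
        augVertexClass_single]
      exact zsmul_mem (AddSubgroup.subset_closure (Set.mem_range_self _)) n
  · rw [genClassSpan, AddSubgroup.closure_le]
    rintro _ ⟨e, rfl⟩
    exact ⟨Finsupp.single (augVertex I e) 1, augVertexClass_single _⟩

/-- Because of the degree shift, reduced degree 0 is degree 1 of `augChainComplex`, where
`homologyOne_equiv_map_ker` applies. -/
theorem reducedHomology_zero_equiv (hsymm : ∀ a b, I a b → I b a) :
    Nonempty (reducedHomology (commutingScheme I) 0 ≃+
      ↥((genWeight I Set.univ).ker ⊓ genClassSpan I Set.univ)) := by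
  have hd : ∀ n, (augChainComplex (commutingScheme I)).d (n + 1) n =
      AddCommGrpCat.ofHom (augBoundary (commutingScheme I) n) := fun n =>
    ChainComplex.of_d (fun n => AddCommGrpCat.of (AugSimplex (commutingScheme I) n →₀ ℤ))
      (fun n => AddCommGrpCat.ofHom (augBoundary (commutingScheme I) n)) n
  obtain ⟨e⟩ := homologyOne_equiv_map_ker (augChainComplex (commutingScheme I))
    (augVertexClass I) (by rw [hd 1]; exact augVertexClass_ker hsymm)
  refine ⟨e.trans (AddEquiv.addSubgroupCongr ?_)⟩
  rw [hd 0, ← augVertexClass_range]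
  ext q
  constructor
  · rintro ⟨x, hx, rfl⟩
    exact ⟨(augBoundary_zero_eq_zero_iff x).mp hx, x, rfl⟩
  · rintro ⟨hq, x, rfl⟩
    exact ⟨x, (augBoundary_zero_eq_zero_iff x).mpr hq, rfl⟩

/-- A subgroup of a free abelian group of finite rank is free; the rank is finite because `Option E`
surjects onto the classes. -/
theorem reducedHomology_zero_free [Finite E] (hsymm : ∀ a b, I a b → I b a) :
    Module.Free ℤ (reducedHomology (commutingScheme I) 0) := by
  obtain ⟨e⟩ := reducedHomology_zero_equiv hsymm
  have : Finite (Quot (GenRel I Set.univ)) := Finite.of_surjective _ Quot.mk_surjective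
  have : Module.Free ℤ (AddSubgroup.toIntSubmodule
    ((genWeight I Set.univ).ker ⊓ genClassSpan I Set.univ)) := inferInstance
  exact Module.Free.of_equiv' this e.symm.toIntLinearEquiv

end Reduced
/-! ### The differentials of the complex of a functor in low degrees -/

section LowDegree

variable {A : Type u} [Category.{v} A] (F : A ⥤ AddCommGrpCat.{w})

open scoped Classical in
/-- The element `x` of the summand of the simplex `σ`. -/
noncomputable def colimChain {n : ℕ} (σ : ComposableArrows A n) :
    F.obj (σ.obj 0) →+ (colimChainComplex F).X n :=
  DirectSum.of (fun σ : ComposableArrows A n => F.obj (σ.obj 0)) σ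

open scoped Classical in
variable {F} in
/-- The homomorphism with prescribed values on the summands. -/
noncomputable def colimChainDesc {n : ℕ} {G : Type*} [AddCommGroup G]
    (g : ∀ σ : ComposableArrows A n, F.obj (σ.obj 0) →+ G) : (colimChainComplex F).X n →+ G :=
  DirectSum.toAddMonoid g

@[simp]
theorem colimChainDesc_colimChain {n : ℕ} {G : Type*} [AddCommGroup G]
    (g : ∀ σ : ComposableArrows A n, F.obj (σ.obj 0) →+ G) (σ : ComposableArrows A n)
    (x : F.obj (σ.obj 0)) : colimChainDesc g (colimChain F σ x) = g σ x := by
  classical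
  exact DirectSum.toAddMonoid_of _ _ _

variable {F} in
theorem colimChain_hom_ext {n : ℕ} {G : Type*} [AddCommGroup G]
    {f g : (colimChainComplex F).X n →+ G}
    (h : ∀ σ x, f (colimChain F σ x) = g (colimChain F σ x)) : f = g := by
  classical
  exact DirectSum.addHom_ext h

/-- The coefficient group depends on the simplex, hence the heterogeneous equality of coefficients.
-/
theorem colimChain_congr {n : ℕ} {σ τ : ComposableArrows A n} (h : σ = τ) {x : F.obj (σ.obj 0)}
    {y : F.obj (τ.obj 0)} (hxy : HEq x y) : colimChain F σ x = colimChain F τ y := by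
  subst h
  rw [eq_of_heq hxy]

theorem colimChainComplex_d_colimChain {n : ℕ} (σ : ComposableArrows A (n + 1))
    (x : F.obj (σ.obj 0)) :
    (colimChainComplex F).d (n + 1) n (colimChain F σ x) =
      ∑ i : Fin (n + 2), (-1 : ℤ) ^ (i : ℕ) • colimChain F
        (σ.whiskerLeft (SimplexCategory.δ i).toOrderHom.monotone.functor)
        (F.map (σ.map (homOfLE (Fin.zero_le ((SimplexCategory.δ i).toOrderHom 0)))) x) := by
  have h : (colimChainComplex F).d (n + 1) n =
      ∑ i : Fin (n + 2), (-1 : ℤ) ^ (i : ℕ) • (simplicialReplacement F).δ i :=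
    AlgebraicTopology.AlternatingFaceMapComplex.obj_d_eq _ _
  rw [h]
  refine (DFunLike.congr_fun (map_sum AddCommGrpCat.homAddEquiv _ _) _).trans ?_
  refine (AddMonoidHom.finsetSum_apply _ _ _).trans (Finset.sum_congr rfl fun i _ => ?_)
  exact congrArg ((-1 : ℤ) ^ (i : ℕ) • ·) (simplicialReplacementMap_of F (SimplexCategory.δ i) σ x)

/-- The element `x` of the summand of the `0`-simplex `X`. -/
noncomputable def colimChain₀ (X : A) : F.obj X →+ (colimChainComplex F).X 0 :=
  colimChain F (.mk₀ X)

/-- The element `x` of the summand of the `1`-simplex `f`. -/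
noncomputable def colimChain₁ {X Y : A} (f : X ⟶ Y) : F.obj X →+ (colimChainComplex F).X 1 :=
  colimChain F (.mk₁ f)

/-- The element `x` of the summand of the `2`-simplex `(f, g)`. -/
noncomputable def colimChain₂ {X Y Z : A} (f : X ⟶ Y) (g : Y ⟶ Z) :
    F.obj X →+ (colimChainComplex F).X 2 :=
  colimChain F (.mk₂ f g)

/-- Only the face omitting the initial object moves the coefficient along `f`; the other face uses
an identity. The same holds in degree 2. -/
theorem colimChainComplex_d_one {X Y : A} (f : X ⟶ Y) (x : F.obj X) :
    (colimChainComplex F).d 1 0 (colimChain₁ F f x) =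
      colimChain₀ F Y (F.map f x) - colimChain₀ F X x := by
  refine (colimChainComplex_d_colimChain F _ _).trans ?_
  rw [Fin.sum_univ_two, sub_eq_add_neg]
  refine congrArg₂ _ ((one_zsmul _).trans ?_) ((neg_one_zsmul _).trans (congrArg _ ?_))
  · refine colimChain_congr F ?_ ?_
    · exact ComposableArrows.ext₀ rfl
    · exact HEq.rfl
  · refine colimChain_congr F ?_ ?_
    · exact ComposableArrows.ext₀ rfl
    · exact heq_of_eq (ConcreteCategory.congr_hom (F.map_id X) x)

theorem colimChainComplex_d_two {X Y Z : A} (f : X ⟶ Y) (g : Y ⟶ Z) (x : F.obj X) :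
    (colimChainComplex F).d 2 1 (colimChain₂ F f g x) =
      colimChain₁ F g (F.map f x) - colimChain₁ F (f ≫ g) x +
        colimChain₁ F f x := by
  refine (colimChainComplex_d_colimChain F _ _).trans ?_
  rw [Fin.sum_univ_three, sub_eq_add_neg]
  refine congrArg₂ _ (congrArg₂ _ ((one_zsmul _).trans ?_)
    ((neg_one_zsmul _).trans (congrArg _ ?_))) ((congrArg (· • _) (by simp)).trans
      ((one_zsmul _).trans ?_))
  · refine colimChain_congr F ?_ ?_
    · refine ComposableArrows.ext₁ rfl rfl ?_
      exact ((Category.id_comp _).trans (Category.comp_id _)).symm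
    · exact HEq.rfl
  · refine colimChain_congr F ?_ ?_
    · refine ComposableArrows.ext₁ rfl rfl ?_
      exact ((Category.id_comp _).trans (Category.comp_id _)).symm
    · exact heq_of_eq (ConcreteCategory.congr_hom (F.map_id X) x)
  · refine colimChain_congr F ?_ ?_
    · refine ComposableArrows.ext₁ rfl rfl ?_
      exact ((Category.id_comp _).trans (Category.comp_id _)).symm
    · exact heq_of_eq (ConcreteCategory.congr_hom (F.map_id X) x)

variable {F} in
theorem colimChain₀_hom_ext {G : Type*} [AddCommGroup G] {f g : (colimChainComplex F).X 0 →+ G}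
    (h : ∀ X x, f (colimChain₀ F X x) = g (colimChain₀ F X x)) : f = g := by
  refine colimChain_hom_ext fun σ x => ?_
  obtain ⟨X, rfl⟩ := ComposableArrows.mk₀_surjective σ
  exact h X x

variable {F} in
theorem colimChain₁_hom_ext {G : Type*} [AddCommGroup G] {f g : (colimChainComplex F).X 1 →+ G}
    (h : ∀ (X Y : A) (a : X ⟶ Y) (x : F.obj X), f (colimChain₁ F a x) = g (colimChain₁ F a x)) :
    f = g := by
  refine colimChain_hom_ext fun σ x => ?_
  obtain ⟨X, Y, a, rfl⟩ := ComposableArrows.mk₁_surjective σ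
  exact h X Y a x

variable {F} in
theorem colimChain₂_hom_ext {G : Type*} [AddCommGroup G] {f g : (colimChainComplex F).X 2 →+ G}
    (h : ∀ (X Y Z : A) (a : X ⟶ Y) (b : Y ⟶ Z) (x : F.obj X),
      f (colimChain₂ F a b x) = g (colimChain₂ F a b x)) : f = g := by
  refine colimChain_hom_ext fun σ x => ?_
  obtain ⟨X, Y, Z, a, b, rfl⟩ := ComposableArrows.mk₂_surjective σ
  exact h X Y Z a b x

end LowDegree
/-! ### The first derived colimit for a pointed set with one point -/

section OnePoint

variable {E : Type u} {I : E → E → Prop}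

@[elab_as_elim]
-- Letters are peeled off on the left because a right action applies the leftmost letter first.
theorem PartiallyCommMonoid.gen_mul_induction {P : PartiallyCommMonoid I → Prop} (h1 : P 1)
    (hmul : ∀ e m, P m → P (PartiallyCommMonoid.gen I e * m)) (m : PartiallyCommMonoid I) :
    P m := by
  induction m using PresentedMonoid.inductionOn with | h w => ?_
  induction w using FreeMonoid.recOn with
  | one => exact h1
  | of_mul e w ih => exact hmul e _ ih

theorem PartiallyCommMonoid.gen_mul_gen {a b : E} (h : I a b) :
    PartiallyCommMonoid.gen I a * PartiallyCommMonoid.gen I b =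
      PartiallyCommMonoid.gen I b * PartiallyCommMonoid.gen I a :=
  PresentedMonoid.mk_eq_mk_of_rel (CommRelation.comm a b h)

open scoped Classical in
/-- The action of `M(E, I)` on `GenClassGroup I T` by affine maps: a generator `e` acts by
`q ↦ genClass e + q` if `e ∉ T`, and by `q ↦ genClass e` if `e ∈ T`. -/
noncomputable def crossedAction (hsymm : ∀ a b, I a b → I b a) (T : Set E) :
    PartiallyCommMonoid I →* Function.End (GenClassGroup I T) :=
  -- A crossed homomorphism is not multiplicative, but the associated affine maps are, so the
  -- presentation can be used; evaluation at 0 recovers it.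
  PresentedMonoid.lift (M := Function.End (GenClassGroup I T)) (fun e q => genClass I T e + if e ∈ T then 0 else q) (by
    rintro _ _ ⟨a, b, h⟩
    funext q
    simp only [map_mul]
    change genClass I T a + (if a ∈ T then 0 else genClass I T b + if b ∈ T then 0 else q) =
      genClass I T b + (if b ∈ T then 0 else genClass I T a + if a ∈ T then 0 else q)
    -- The cases use gluing, collapsing (twice), and commutativity of addition.
    by_cases ha : a ∈ T <;> by_cases hb : b ∈ T
    · simp [ha, hb, genClass_eq h ha hb]
    · simp [ha, hb, genClass_eq_zero (hsymm _ _ h) hb ha]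
    · simp [ha, hb, genClass_eq_zero h ha hb]
    · simp only [ha, hb, if_false]
      abel)

open scoped Classical in
-- Multiplication in `Function.End` is composition, so the leftmost generator acts last and, if it
-- lies in `T`, erases everything to its right.
theorem crossedAction_gen_mul (hsymm : ∀ a b, I a b → I b a) (T : Set E) (e : E)
    (m : PartiallyCommMonoid I) (q : GenClassGroup I T) :
    crossedAction hsymm T (PartiallyCommMonoid.gen I e * m) q =
      genClass I T e + if e ∈ T then 0 else crossedAction hsymm T m q := by
  rw [map_mul]
  rfl

variable [PointedRightAction (PartiallyCommMonoid I) (Fin 1)]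

variable (I) in
/-- The generators that send the point to the base point. -/
def killingGens : Set E :=
  {e | (PointedSet.pt 0 : PointedSet (Fin 1)) <• PartiallyCommMonoid.gen I e = PointedSet.base}

theorem PointedSet.eq_base_or_eq_pt (p : PointedSet (Fin 1)) :
    p = PointedSet.base ∨ p = PointedSet.pt 0 := by
  rcases p with _ | i
  · exact Or.inl rfl
  · exact Or.inr (by rw [Subsingleton.elim i 0])

theorem act_gen_of_notMem {e : E} (he : e ∉ killingGens I) :
    (PointedSet.pt 0 : PointedSet (Fin 1)) <• PartiallyCommMonoid.gen I e = PointedSet.pt 0 :=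
  (PointedSet.eq_base_or_eq_pt _).resolve_left he

theorem act_mul (p : PointedSet (Fin 1)) (m m' : PartiallyCommMonoid I) :
    p <• (m * m') = (p <• m) <• m' := by
  rw [MulOpposite.op_mul, mul_smul]

/-- The value at `m` of the universal crossed homomorphism. -/
noncomputable def crossedClass (hsymm : ∀ a b, I a b → I b a) (m : PartiallyCommMonoid I) :
    GenClassGroup I (killingGens I) :=
  crossedAction hsymm (killingGens I) m 0

theorem crossedClass_one (hsymm : ∀ a b, I a b → I b a) : crossedClass hsymm 1 = 0 := by
  rw [crossedClass, map_one]
  rfl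

theorem crossedClass_gen_mul_of_mem (hsymm : ∀ a b, I a b → I b a) {e : E}
    (he : e ∈ killingGens I) (m : PartiallyCommMonoid I) :
    crossedClass hsymm (PartiallyCommMonoid.gen I e * m) = genClass I _ e := by
  rw [crossedClass, crossedAction_gen_mul, if_pos he, add_zero]

theorem crossedClass_gen_mul_of_notMem (hsymm : ∀ a b, I a b → I b a) {e : E}
    (he : e ∉ killingGens I) (m : PartiallyCommMonoid I) :
    crossedClass hsymm (PartiallyCommMonoid.gen I e * m) =
      genClass I _ e + crossedClass hsymm m := by
  rw [crossedClass, crossedAction_gen_mul, if_neg he, crossedClass]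

theorem crossedClass_gen (hsymm : ∀ a b, I a b → I b a) (e : E) :
    crossedClass hsymm (PartiallyCommMonoid.gen I e) = genClass I _ e := by
  rw [← mul_one (PartiallyCommMonoid.gen I e)]
  by_cases he : e ∈ killingGens I
  · exact crossedClass_gen_mul_of_mem hsymm he 1
  · rw [crossedClass_gen_mul_of_notMem hsymm he 1, crossedClass_one, add_zero]

/-- Reading `m` from the left, one meets a generator of `T`; its constant map absorbs the rest of
`m` and all of `m'`. -/
theorem crossedClass_mul_of_act_eq_base (hsymm : ∀ a b, I a b → I b a)
    {m : PartiallyCommMonoid I}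
    (hm : (PointedSet.pt 0 : PointedSet (Fin 1)) <• m = PointedSet.base)
    (m' : PartiallyCommMonoid I) : crossedClass hsymm (m * m') = crossedClass hsymm m := by
  induction m using PartiallyCommMonoid.gen_mul_induction with
  | h1 => rw [MulOpposite.op_one, one_smul] at hm; cases hm
  | hmul e m ih =>
    rw [mul_assoc]
    by_cases he : e ∈ killingGens I
    · rw [crossedClass_gen_mul_of_mem hsymm he, crossedClass_gen_mul_of_mem hsymm he]
    · rw [act_mul, act_gen_of_notMem he] at hm
      rw [crossedClass_gen_mul_of_notMem hsymm he, crossedClass_gen_mul_of_notMem hsymm he, ih hm]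

/-- No letter of `m` lies in `T`, so `m` acts by a translation. -/
theorem crossedClass_mul_of_act_eq_pt (hsymm : ∀ a b, I a b → I b a)
    {m : PartiallyCommMonoid I}
    (hm : (PointedSet.pt 0 : PointedSet (Fin 1)) <• m = PointedSet.pt 0)
    (m' : PartiallyCommMonoid I) :
    crossedClass hsymm (m * m') = crossedClass hsymm m + crossedClass hsymm m' := by
  induction m using PartiallyCommMonoid.gen_mul_induction with
  | h1 => rw [one_mul, crossedClass_one, zero_add]
  | hmul e m ih =>
    rw [act_mul] at hm
    by_cases he : e ∈ killingGens I
    -- The base point is fixed, so a word starting with a killing generator cannot end at `x₀`.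
    · rw [show _ = PointedSet.base from he, PointedRightAction.base_act] at hm
      cases hm
    · rw [act_gen_of_notMem he] at hm
      rw [mul_assoc, crossedClass_gen_mul_of_notMem hsymm he,
        crossedClass_gen_mul_of_notMem hsymm he, ih hm, add_assoc]

theorem crossedClass_mem_span (hsymm : ∀ a b, I a b → I b a) (m : PartiallyCommMonoid I) :
    crossedClass hsymm m ∈ genClassSpan I (killingGens I) := by
  have hgen : ∀ e, genClass I (killingGens I) e ∈ genClassSpan I (killingGens I) :=
    fun e => AddSubgroup.subset_closure (Set.mem_range_self e)
  induction m using PartiallyCommMonoid.gen_mul_induction with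
  | h1 => rw [crossedClass_one]; exact zero_mem _
  | hmul e m ih =>
    by_cases he : e ∈ killingGens I
    · rw [crossedClass_gen_mul_of_mem hsymm he]
      exact hgen e
    · rw [crossedClass_gen_mul_of_notMem hsymm he]
      exact add_mem (hgen e) ih

/-- Only the first killing generator contributes: earlier letters have weight 0 and later ones are
erased. -/
theorem genWeight_crossedClass_of_act_eq_base (hsymm : ∀ a b, I a b → I b a)
    {m : PartiallyCommMonoid I}
    (hm : (PointedSet.pt 0 : PointedSet (Fin 1)) <• m = PointedSet.base) :
    genWeight I (killingGens I) (crossedClass hsymm m) = 1 := by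
  induction m using PartiallyCommMonoid.gen_mul_induction with
  | h1 => rw [MulOpposite.op_one, one_smul] at hm; cases hm
  | hmul e m ih =>
    by_cases he : e ∈ killingGens I
    · rw [crossedClass_gen_mul_of_mem hsymm he, genWeight_genClass_of_mem he]
    · rw [act_mul, act_gen_of_notMem he] at hm
      rw [crossedClass_gen_mul_of_notMem hsymm he, map_add, ih hm,
        genWeight_genClass_of_notMem he, zero_add]

theorem genWeight_crossedClass_of_act_eq_pt (hsymm : ∀ a b, I a b → I b a)
    {m : PartiallyCommMonoid I}
    (hm : (PointedSet.pt 0 : PointedSet (Fin 1)) <• m = PointedSet.pt 0) :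
    genWeight I (killingGens I) (crossedClass hsymm m) = 0 := by
  induction m using PartiallyCommMonoid.gen_mul_induction with
  | h1 => rw [crossedClass_one, map_zero]
  | hmul e m ih =>
    rw [act_mul] at hm
    by_cases he : e ∈ killingGens I
    · rw [show _ = PointedSet.base from he, PointedRightAction.base_act] at hm
      cases hm
    · rw [act_gen_of_notMem he] at hm
      rw [crossedClass_gen_mul_of_notMem hsymm he, map_add, ih hm,
        genWeight_genClass_of_notMem he, zero_add]

/-! ### Chains with coefficients in `ℤ[x₀]` -/

/-- The homomorphism `n ↦ n • q` on the values of `ℤ[X]` at points, and `0` at the base point. -/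
def intCoeffDesc {X : Type v} {G : Type*} [AddCommGroup G] (q : G) :
    (p : PointedSet X) → intCoeffObj p →+ G
  | .pt _ => zmultiplesHom G q
  | .base => 0

variable (I) in
/-- The category of `{x₀, *}`. -/
abbrev OnePointCat : Type := PointedSetCat (PartiallyCommMonoid I) (Fin 1)

variable (I) in
/-- The functor `ℤ[x₀]`. -/
abbrev onePointCoeff : OnePointCat I ⥤ AddCommGrpCat.{0} :=
  intCoeff (PartiallyCommMonoid I) (Fin 1)

namespace OnePointCat

/-- A point as an object. -/
abbrev ob (p : PointedSet (Fin 1)) : OnePointCat I := ⟨(), p⟩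

/-- The element of the monoid that gives a morphism. -/
def label {x y : OnePointCat I} (f : x ⟶ y) : PartiallyCommMonoid I :=
  MulOpposite.unop (show (PartiallyCommMonoid I)ᵐᵒᵖ from f.val)

/-- The morphism given by an element of the monoid. -/
def arrow {p q : PointedSet (Fin 1)} (m : PartiallyCommMonoid I) (h : p <• m = q) :
    (ob p : OnePointCat I) ⟶ ob q :=
  ⟨MulOpposite.op m, h⟩

theorem act_label {x y : OnePointCat I} (f : x ⟶ y) : x.back <• label f = y.back := f.property

/-- The generator of the value of `ℤ[x₀]` at `x₀`. -/
def unit : (onePointCoeff I).obj (ob (.pt 0)) := (1 : ℤ)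

end OnePointCat

open OnePointCat

variable (I) in
/-- The group of `n`-chains with coefficients in `ℤ[x₀]`. -/
noncomputable abbrev OnePointChain (n : ℕ) : AddCommGrpCat.{u} := (colimChainComplex (onePointCoeff I)).X n

variable (I) in
/-- The differential from `(n + 1)`-chains to `n`-chains. -/
noncomputable abbrev onePointD (n : ℕ) : OnePointChain I (n + 1) →+ OnePointChain I n :=
  ((colimChainComplex (onePointCoeff I)).d (n + 1) n).hom

variable (I) in
/-- The `0`-chain given by the object `x₀`. -/
noncomputable def pointChain : OnePointChain I 0 :=
  colimChain₀ (onePointCoeff I) (ob (.pt 0)) unit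

/-- The `1`-chain given by a morphism from `x₀`. -/
noncomputable def arrowChain {q : PointedSet (Fin 1)} (m : PartiallyCommMonoid I)
    (h : (PointedSet.pt 0 : PointedSet (Fin 1)) <• m = q) : OnePointChain I 1 :=
  colimChain₁ (onePointCoeff I) (arrow m h) unit

/-- The `2`-chain given by two composable morphisms, the first one from `x₀`. -/
noncomputable def arrowPairChain {p q : PointedSet (Fin 1)} (m m' : PartiallyCommMonoid I)
    (h : (PointedSet.pt 0 : PointedSet (Fin 1)) <• m = p) (h' : p <• m' = q) :
    OnePointChain I 2 :=
  colimChain₂ (onePointCoeff I) (arrow m h) (arrow m' h') unit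

theorem OnePointCat.unit_hom_ext {G : Type*} [AddCommGroup G]
    {f g : (onePointCoeff I).obj (ob (.pt 0)) →+ G} (h : f unit = g unit) : f = g :=
  AddMonoidHom.ext_int (f := (f : ℤ →+ G)) (g := (g : ℤ →+ G)) h

theorem OnePointCat.base_hom_ext {G : Type*} [AddCommGroup G]
    (f g : (onePointCoeff I).obj (ob .base) →+ G) : f = g := by
  ext n
  have hn : n = 0 := rfl
  rw [hn, map_zero, map_zero]

/-- Summands starting at `*` are zero and those starting at `x₀` are copies of `ℤ`, so homomorphisms
are tested on unit chains from `x₀`. -/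
theorem pointChain_hom_ext {G : Type*} [AddCommGroup G] {f g : OnePointChain I 0 →+ G}
    (h : f (pointChain I) = g (pointChain I)) : f = g := by
  refine colimChain₀_hom_ext fun X => DFunLike.congr_fun
    (f := f.comp (colimChain₀ _ X)) (g := g.comp (colimChain₀ _ X)) ?_
  obtain ⟨⟨⟩, p⟩ := X
  obtain rfl | rfl := PointedSet.eq_base_or_eq_pt p
  · exact base_hom_ext _ _
  · exact unit_hom_ext h

theorem arrowChain_hom_ext {G : Type*} [AddCommGroup G] {f g : OnePointChain I 1 →+ G}
    (h : ∀ (q : PointedSet (Fin 1)) (m : PartiallyCommMonoid I)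
      (hm : (PointedSet.pt 0 : PointedSet (Fin 1)) <• m = q),
      f (arrowChain m hm) = g (arrowChain m hm)) : f = g := by
  refine colimChain₁_hom_ext fun X Y a => DFunLike.congr_fun
    (f := f.comp (colimChain₁ _ a)) (g := g.comp (colimChain₁ _ a)) ?_
  obtain ⟨⟨⟩, p⟩ := X
  obtain ⟨⟨⟩, q⟩ := Y
  obtain rfl | rfl := PointedSet.eq_base_or_eq_pt p
  · exact base_hom_ext _ _
  · exact unit_hom_ext (h q (label a) (act_label a))

theorem arrowPairChain_hom_ext {G : Type*} [AddCommGroup G] {f g : OnePointChain I 2 →+ G}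
    (h : ∀ (p q : PointedSet (Fin 1)) (m m' : PartiallyCommMonoid I)
      (hm : (PointedSet.pt 0 : PointedSet (Fin 1)) <• m = p) (hm' : p <• m' = q),
      f (arrowPairChain m m' hm hm') = g (arrowPairChain m m' hm hm')) : f = g := by
  refine colimChain₂_hom_ext fun X Y Z a b => DFunLike.congr_fun
    (f := f.comp (colimChain₂ _ a b)) (g := g.comp (colimChain₂ _ a b)) ?_
  obtain ⟨⟨⟩, p⟩ := X
  obtain ⟨⟨⟩, q⟩ := Y
  obtain ⟨⟨⟩, r⟩ := Z
  obtain rfl | rfl := PointedSet.eq_base_or_eq_pt p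
  · exact base_hom_ext _ _
  · exact unit_hom_ext (h q r (label a) (label b) (act_label a) (act_label b))

theorem onePointD_zero_of_pt {m : PartiallyCommMonoid I}
    (h : (PointedSet.pt 0 : PointedSet (Fin 1)) <• m = PointedSet.pt 0) :
    onePointD I 0 (arrowChain m h) = 0 :=
  (colimChainComplex_d_one (onePointCoeff I) (arrow m h) unit).trans
    (sub_self (pointChain I))

theorem onePointD_zero_of_base {m : PartiallyCommMonoid I}
    (h : (PointedSet.pt 0 : PointedSet (Fin 1)) <• m = PointedSet.base) :
    onePointD I 0 (arrowChain m h) = - pointChain I := by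
  refine (colimChainComplex_d_one (onePointCoeff I) (arrow m h) unit).trans ?_
  have h0 : (onePointCoeff I).map (arrow m h) unit = 0 := rfl
  rw [h0, map_zero, zero_sub]
  rfl

theorem onePointD_one_of_pt {m m' : PartiallyCommMonoid I} {q : PointedSet (Fin 1)}
    (h : (PointedSet.pt 0 : PointedSet (Fin 1)) <• m = PointedSet.pt 0)
    (h' : (PointedSet.pt 0 : PointedSet (Fin 1)) <• m' = q) :
    onePointD I 1 (arrowPairChain m m' h h') =
      arrowChain m' h' - arrowChain (m * m') (by rw [act_mul, h, h']) + arrowChain m h :=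
  colimChainComplex_d_two (onePointCoeff I) (arrow m h) (arrow m' h') unit

/-- The face that omits `x₀` starts at `*`, where its coefficient is 0; this is why additivity fails
here. -/
theorem onePointD_one_of_base {m m' : PartiallyCommMonoid I} {q : PointedSet (Fin 1)}
    (h : (PointedSet.pt 0 : PointedSet (Fin 1)) <• m = PointedSet.base)
    (h' : (PointedSet.base : PointedSet (Fin 1)) <• m' = q) :
    onePointD I 1 (arrowPairChain m m' h h') =
      arrowChain m h - arrowChain (m * m') (by rw [act_mul, h, h']) := by
  refine (colimChainComplex_d_two (onePointCoeff I) (arrow m h) (arrow m' h') unit).trans ?_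
  have h0 : (onePointCoeff I).map (arrow m h) unit = 0 := rfl
  rw [h0, map_zero, zero_sub, neg_add_eq_sub]
  rfl

/-- The homomorphism from the group of `1`-chains given by the universal crossed homomorphism. -/
noncomputable def crossedChain (hsymm : ∀ a b, I a b → I b a) :
    OnePointChain I 1 →+ GenClassGroup I (killingGens I) :=
  colimChainDesc fun σ => intCoeffDesc (crossedClass hsymm (label σ.hom)) (σ.obj 0).back

theorem crossedChain_arrowChain (hsymm : ∀ a b, I a b → I b a) {q : PointedSet (Fin 1)}
    (m : PartiallyCommMonoid I) (h : (PointedSet.pt 0 : PointedSet (Fin 1)) <• m = q) :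
    crossedChain hsymm (arrowChain m h) = crossedClass hsymm m :=
  (colimChainDesc_colimChain _ _ _ _).trans (one_zsmul _)

/-- The two product rules for `crossedClass` match the two shapes of a boundary. -/
theorem crossedChain_comp_d (hsymm : ∀ a b, I a b → I b a) :
    (crossedChain hsymm).comp (onePointD I 1) = 0 := by
  refine arrowPairChain_hom_ext fun p q m m' hm hm' => ?_
  rw [AddMonoidHom.comp_apply, AddMonoidHom.zero_apply]
  obtain rfl | rfl := PointedSet.eq_base_or_eq_pt p
  · rw [onePointD_one_of_base, map_sub, crossedChain_arrowChain, crossedChain_arrowChain,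
      crossedClass_mul_of_act_eq_base hsymm hm, sub_self]
  · rw [onePointD_one_of_pt, map_add, map_sub, crossedChain_arrowChain, crossedChain_arrowChain,
      crossedChain_arrowChain, crossedClass_mul_of_act_eq_pt hsymm hm, sub_add_cancel_right,
      neg_add_cancel]

/-! ### Chains modulo boundaries -/

variable (I) in
/-- The class modulo boundaries of the `1`-chain given by an element of the monoid. -/
noncomputable def chainClass (m : PartiallyCommMonoid I) :
    OnePointChain I 1 ⧸ (onePointD I 1).range :=
  QuotientAddGroup.mk' _ (arrowChain m rfl)

/-- This absorbs the varying targets and proofs of arrows, so that classes depend on the monoid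
element alone. -/
theorem mk_arrowChain {q : PointedSet (Fin 1)} (m : PartiallyCommMonoid I)
    (h : (PointedSet.pt 0 : PointedSet (Fin 1)) <• m = q) :
    QuotientAddGroup.mk' (onePointD I 1).range (arrowChain m h) = chainClass I m := by
  subst h
  rfl

theorem mk_onePointD (x : OnePointChain I 2) :
    QuotientAddGroup.mk' (onePointD I 1).range (onePointD I 1 x) = 0 :=
  (QuotientAddGroup.eq_zero_iff _).mpr ⟨x, rfl⟩

theorem chainClass_mul_of_act_eq_base {m : PartiallyCommMonoid I}
    (hm : (PointedSet.pt 0 : PointedSet (Fin 1)) <• m = PointedSet.base)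
    (m' : PartiallyCommMonoid I) : chainClass I (m * m') = chainClass I m := by
  have h := mk_onePointD (arrowPairChain m m' hm rfl)
  rw [onePointD_one_of_base, map_sub, mk_arrowChain, mk_arrowChain, sub_eq_zero] at h
  exact h.symm

theorem chainClass_mul_of_act_eq_pt {m : PartiallyCommMonoid I}
    (hm : (PointedSet.pt 0 : PointedSet (Fin 1)) <• m = PointedSet.pt 0)
    (m' : PartiallyCommMonoid I) :
    chainClass I (m * m') = chainClass I m + chainClass I m' := by
  have h := mk_onePointD (arrowPairChain m m' hm rfl)
  rw [onePointD_one_of_pt, map_add, map_sub, mk_arrowChain, mk_arrowChain, mk_arrowChain,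
    sub_add_eq_add_sub, sub_eq_zero] at h
  exact h.symm.trans (add_comm _ _)

theorem chainClass_one : chainClass I 1 = 0 := by
  have h := chainClass_mul_of_act_eq_pt (I := I) (m := 1)
    (by rw [MulOpposite.op_one, one_smul]) 1
  rw [mul_one] at h
  exact left_eq_add.mp h

variable (I) in
/-- The inverse of the homomorphism induced by `crossedChain`. -/
noncomputable def genClassToChain : GenClassGroup I (killingGens I) →+
    OnePointChain I 1 ⧸ (onePointD I 1).range :=
  GenClassGroup.desc (fun e => chainClass I (PartiallyCommMonoid.gen I e))
    (fun a b h ha hb => by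
      -- `[a] = [ab] = [ba] = [b]`.
      rw [← chainClass_mul_of_act_eq_base ha (PartiallyCommMonoid.gen I b),
        PartiallyCommMonoid.gen_mul_gen h, chainClass_mul_of_act_eq_base hb])
    (fun a b h ha hb => by
      -- `[a] + [b] = [ab] = [ba] = [b]`, whence `[a] = 0`.
      have h₁ := chainClass_mul_of_act_eq_pt (act_gen_of_notMem ha) (PartiallyCommMonoid.gen I b)
      rw [PartiallyCommMonoid.gen_mul_gen h, chainClass_mul_of_act_eq_base hb] at h₁
      exact right_eq_add.mp h₁)

/-- Both sides satisfy the same recursion when a generator is added on the left. -/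
theorem genClassToChain_crossedClass (hsymm : ∀ a b, I a b → I b a) (m : PartiallyCommMonoid I) :
    genClassToChain I (crossedClass hsymm m) = chainClass I m := by
  induction m using PartiallyCommMonoid.gen_mul_induction with
  | h1 => rw [crossedClass_one, chainClass_one, map_zero]
  | hmul e m ih =>
    by_cases he : e ∈ killingGens I
    · rw [crossedClass_gen_mul_of_mem hsymm he, chainClass_mul_of_act_eq_base he]
      exact GenClassGroup.desc_genClass _ _ _ e
    · rw [crossedClass_gen_mul_of_notMem hsymm he,
        chainClass_mul_of_act_eq_pt (act_gen_of_notMem he), map_add, ih]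
      exact congrArg (· + _) (GenClassGroup.desc_genClass _ _ _ e)

theorem genClassToChain_comp_crossedChain (hsymm : ∀ a b, I a b → I b a) :
    (genClassToChain I).comp (crossedChain hsymm) = QuotientAddGroup.mk' _ :=
  arrowChain_hom_ext fun q m hm => by
    rw [AddMonoidHom.comp_apply, crossedChain_arrowChain, genClassToChain_crossedClass,
      mk_arrowChain]

theorem crossedChain_ker (hsymm : ∀ a b, I a b → I b a) :
    (crossedChain hsymm).ker = (onePointD I 1).range :=
  AddMonoidHom.ker_eq_range_of_factor _ _ (genClassToChain I) (crossedChain_comp_d hsymm)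
    (genClassToChain_comp_crossedChain hsymm)

theorem crossedChain_range (hsymm : ∀ a b, I a b → I b a) :
    (crossedChain hsymm).range = genClassSpan I (killingGens I) := by
  refine le_antisymm ?_ ?_
  -- Passing to the quotient by the span turns the inclusion into an equality of homomorphisms,
  -- testable on single arrows.
  · have h : (QuotientAddGroup.mk' (genClassSpan I (killingGens I))).comp
        (crossedChain hsymm) = 0 :=
      arrowChain_hom_ext fun q m hm => (QuotientAddGroup.eq_zero_iff _).mpr <| by
        rw [crossedChain_arrowChain]
        exact crossedClass_mem_span hsymm m
    rintro _ ⟨x, rfl⟩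
    exact (QuotientAddGroup.eq_zero_iff _).mp (DFunLike.congr_fun h x)
  · rw [genClassSpan, AddSubgroup.closure_le]
    rintro _ ⟨e, rfl⟩
    exact ⟨arrowChain (PartiallyCommMonoid.gen I e) rfl,
      (crossedChain_arrowChain hsymm _ _).trans (crossedClass_gen hsymm e)⟩

/-! ### Cycles and the weight -/

variable (I) in
/-- The isomorphism from the group of `0`-chains to `ℤ`. -/
noncomputable def pointCoeff : OnePointChain I 0 →+ ℤ :=
  colimChainDesc fun σ => intCoeffDesc (1 : ℤ) (σ.obj 0).back

theorem pointCoeff_pointChain : pointCoeff I (pointChain I) = 1 :=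
  (colimChainDesc_colimChain _ _ _ _).trans (one_zsmul _)

theorem pointCoeff_injective : Function.Injective (pointCoeff I) := by
  have h : (zmultiplesHom _ (pointChain I)).comp (pointCoeff I) = AddMonoidHom.id _ :=
    pointChain_hom_ext (by
      rw [AddMonoidHom.comp_apply, pointCoeff_pointChain, zmultiplesHom_apply, one_zsmul,
        AddMonoidHom.id_apply])
  exact Function.LeftInverse.injective (g := zmultiplesHom _ (pointChain I))
    (DFunLike.congr_fun h)

/-- An arrow to `*` has boundary `-pointChain` and weight 1; a loop at `x₀` has zero for both. So
the boundary is minus the weight. -/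
theorem onePointD_zero_eq_zero_iff (hsymm : ∀ a b, I a b → I b a) (x : OnePointChain I 1) :
    onePointD I 0 x = 0 ↔ genWeight I (killingGens I) (crossedChain hsymm x) = 0 := by
  have h : (pointCoeff I).comp (onePointD I 0) =
      -(genWeight I (killingGens I)).comp (crossedChain hsymm) := by
    refine arrowChain_hom_ext fun q m hm => ?_
    rw [AddMonoidHom.comp_apply, AddMonoidHom.neg_apply, AddMonoidHom.comp_apply,
      crossedChain_arrowChain]
    obtain rfl | rfl := PointedSet.eq_base_or_eq_pt q
    · rw [onePointD_zero_of_base, map_neg, pointCoeff_pointChain,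
        genWeight_crossedClass_of_act_eq_base hsymm hm]
    · rw [onePointD_zero_of_pt, map_zero, genWeight_crossedClass_of_act_eq_pt hsymm hm, neg_zero]
  rw [← neg_eq_zero (a := genWeight I _ _), ← map_eq_zero_iff _ pointCoeff_injective]
  exact Eq.congr_left (DFunLike.congr_fun h x)

theorem derivedColim_one_equiv (hsymm : ∀ a b, I a b → I b a) :
    Nonempty (derivedColim (onePointCoeff I) 1 ≃+
      ↥((genWeight I (killingGens I)).ker ⊓ genClassSpan I (killingGens I))) := by
  obtain ⟨e⟩ := homologyOne_equiv_map_ker (colimChainComplex (onePointCoeff I))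
    (crossedChain hsymm) (crossedChain_ker hsymm)
  refine ⟨e.trans (AddEquiv.addSubgroupCongr ?_)⟩
  rw [← crossedChain_range hsymm]
  ext q
  constructor
  · rintro ⟨x, hx, rfl⟩
    exact ⟨(onePointD_zero_eq_zero_iff hsymm x).mp hx, x, rfl⟩
  · rintro ⟨hq, x, rfl⟩
    exact ⟨x, (onePointD_zero_eq_zero_iff hsymm x).mpr hq, rfl⟩

end OnePoint

theorem mainTheorem6 {E : Type u} [Finite E] [LinearOrder E] (I : E → E → Prop)
    (hirrefl : ∀ a, ¬ I a a) (hsymm : ∀ a b, I a b → I b a)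
    [PointedRightAction (PartiallyCommMonoid I) (Fin 1)] :
    AddCommGroup.torsion (derivedColim (intCoeff (PartiallyCommMonoid I) (Fin 1)) 1) = ⊥ ∧
    ((∀ e : E, (PointedSet.pt 0 : PointedSet (Fin 1)) <• PartiallyCommMonoid.gen I e =
        PointedSet.base) →
      Nonempty (derivedColim (intCoeff (PartiallyCommMonoid I) (Fin 1)) 1 ≃+
        reducedHomology (commutingScheme I) 0)) ∧
    Module.Free ℤ (reducedHomology (commutingScheme I) 0) := by
  obtain ⟨e₁⟩ := derivedColim_one_equiv hsymm
  refine ⟨?_, fun hT => ?_, reducedHomology_zero_free hsymm⟩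
  · refine (AddSubgroup.eq_bot_iff_forall _).mpr fun x hx => ?_
    obtain ⟨n, hn, hx⟩ := isOfFinAddOrder_iff_nsmul_eq_zero.mp hx
    have h : n • (e₁ x).1 = 0 := by
      rw [← AddSubgroup.coe_nsmul, ← map_nsmul, hx, map_zero, AddSubgroup.coe_zero]
    -- The ambient group of integer-valued finitely supported functions is torsion-free.
    have h' : e₁ x = 0 := Subtype.ext ((nsmul_eq_zero_iff_right hn.ne').mp h)
    exact (map_eq_zero_iff e₁ e₁.injective).mp h'
  · obtain ⟨e₂⟩ := reducedHomology_zero_equiv hsymm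
    have h : killingGens I = Set.univ := Set.eq_univ_of_forall hT
    -- After this substitution the targets of `e₁` and `e₂` are the same subgroup.
    rw [h] at e₁
    exact ⟨e₁.trans e₂.symm⟩
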